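/- Let $F$ be a field of characteristic $0$, let $G$ be an arbitrary group (not necessarily finite or abelian), and let $L$ be a finite dimensional Lie algebra over $F$ with a $G$-grading, that is, a vector space decomposition $L=\bigoplus_{g\in G}L^{(g)}$ such that $[L^{(g)},L^{(h)}]\subseteq L^{(gh)}$ for all $g,h\in G$. Then the solvable radical $R$ of $L$ (the largest solvable ideal) and the nilpotent radical $N$ of $L$ (the largest nilpotent ideal) are graded ideals of $L$: $R=\bigoplus_{g\in G}(R\cap L^{(g)})$ and $N=\bigoplus_{g\in G}(N\cap L^{(g)})$. -/

import Mathlib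

/-- The nilpotent radical (nilradical) of a Lie algebra `L`: the supremum (that is, the sum) of all
ideals of `L` which are nilpotent as Lie algebras. For a finite dimensional `L` it is the largest
nilpotent ideal. Note that Mathlib's `LieAlgebra.maxNilpotentIdeal` is a different (smaller) ideal:
it only takes those ideals on which the whole of `L` acts nilpotently. -/
def LieAlgebra.nilpotentRadical (F L : Type*) [CommRing F] [LieRing L] [LieAlgebra F L] :
    LieIdeal F L :=
  sSup {I : LieIdeal F L | LieRing.IsNilpotent I}

/-! Let `A` be the associative algebra generated by the operators `ad x`. In characteristic zero the
nilradical is the trace orthogonal `T = {x | tr (ad x * b) = 0 for all b in A}`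
(`nilpotentRadical_eq_adTraceIdeal`). `A` is spanned by homogeneous operators, and those of degree
other than 1 are traceless, so the condition defining `T` splits over components. The radical is `{x
| [x, L] ⊆ T}`, hence graded as well. -/

open Module Polynomial in
/-- In characteristic zero, an endomorphism all of whose positive powers are traceless is
nilpotent. -/
theorem Module.End.isNilpotent_of_forall_trace_pow_eq_zero {F V : Type*} [Field F] [CharZero F]
    [AddCommGroup V] [Module F V] [FiniteDimensional F V] (f : Module.End F V)
    (h : ∀ k : ℕ, LinearMap.trace F V (f ^ (k + 1)) = 0) : IsNilpotent f := by
  have htr : ∀ p : F[X], LinearMap.trace F V (aeval f (p * X)) = 0 := by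
    intro p
    induction p using Polynomial.induction_on' with
    | add p q hp hq => rw [add_mul, map_add, map_add, hp, hq, add_zero]
    | monomial n a =>
      rw [← C_mul_X_pow_eq_monomial, mul_assoc, ← pow_succ, map_mul, aeval_C, map_pow, aeval_X,
        Module.algebraMap_end_eq_smul_id, smul_mul_assoc, map_smul]
      simpa [Module.End.mul_eq_comp] using Or.inr (h n)
  have hne : minpoly F f ≠ 0 := minpoly.ne_zero (Algebra.IsIntegral.isIntegral f)
  obtain ⟨q, hq, hqX⟩ := exists_eq_pow_rootMultiplicity_mul_and_not_dvd (minpoly F f) hne 0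
  rw [C_0, sub_zero] at hq hqX
  set n := rootMultiplicity 0 (minpoly F f)
  -- Bézout yields the Fitting idempotent `a * X ^ (n + 1)`. The exponent `n + 1` makes it divisible
  -- by `X` even when `n = 0`, so its trace vanishes.
  have hcop : IsCoprime (X ^ (n + 1) : F[X]) q :=
    ((irreducible_X.coprime_iff_not_dvd).mpr hqX).pow_left
  obtain ⟨a, b, hab⟩ := hcop
  have hzero : aeval f (X ^ n * q) = 0 := by rw [← hq, minpoly.aeval]
  have hsum : aeval f (a * X ^ (n + 1)) + aeval f (b * q) = 1 := by
    rw [← map_add, hab, map_one]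
  have hprod : aeval f (a * X ^ (n + 1)) * aeval f (b * q) = 0 := by
    rw [← map_mul, show a * X ^ (n + 1) * (b * q) = a * X * b * (X ^ n * q) by ring, map_mul,
      hzero, mul_zero]
  have hidem : IsIdempotentElem (aeval f (a * X ^ (n + 1))) := by
    rw [IsIdempotentElem]
    conv_rhs => rw [← mul_one (aeval f (a * X ^ (n + 1))), ← hsum, mul_add, hprod, add_zero]
  have he : aeval f (a * X ^ (n + 1)) = 0 := by
    refine LinearMap.IsIdempotentElem.eq_zero_of_trace_eq_zero hidem ?_
    rw [pow_succ, ← mul_assoc]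
    exact htr _
  rw [he, zero_add] at hsum
  refine ⟨n, ?_⟩
  calc f ^ n = f ^ n * aeval f (b * q) := by rw [hsum, mul_one]
    _ = aeval f (b * (X ^ n * q)) := by
      rw [show b * (X ^ n * q) = X ^ n * (b * q) by ring, map_mul _ (X ^ n), map_pow, aeval_X]
    _ = 0 := by rw [map_mul, hzero, mul_zero]

/-! ### The nilradical as a trace orthogonal. -/

namespace LieAlgebra

variable (F L : Type*) [Field F] [LieRing L] [LieAlgebra F L]

/-- The associative enveloping algebra of the adjoint representation. -/
def adEnveloping : Subalgebra F (Module.End F L) :=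
  Algebra.adjoin F (Set.range (ad F L))

variable {F L} in
theorem ad_mem_adEnveloping (x : L) : ad F L x ∈ adEnveloping F L :=
  Algebra.subset_adjoin ⟨x, rfl⟩

theorem ad_lie_eq_mul_sub_mul (x y : L) :
    ad F L ⁅x, y⁆ = ad F L x * ad F L y - ad F L y * ad F L x := by
  ext z
  simp

/-- The ideal of elements whose adjoint operator is orthogonal to the enveloping algebra of the
adjoint representation with respect to the trace form. -/
def adTraceIdeal : LieIdeal F L where
  carrier := {x | ∀ b ∈ adEnveloping F L, LinearMap.trace F L (ad F L x * b) = 0}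
  add_mem' {x y} hx hy b hb := by rw [map_add, add_mul, map_add, hx b hb, hy b hb, add_zero]
  zero_mem' b _ := by rw [map_zero, zero_mul, map_zero]
  smul_mem' c x hx b hb := by rw [map_smul, smul_mul_assoc, map_smul, hx b hb, smul_zero]
  lie_mem {y x} hx b hb := by
    rw [ad_lie_eq_mul_sub_mul, sub_mul, map_sub, mul_assoc, LinearMap.trace_mul_comm, mul_assoc,
      mul_assoc, hx _ (mul_mem hb (ad_mem_adEnveloping y)),
      hx _ (mul_mem (ad_mem_adEnveloping y) hb), sub_zero]

variable {F L}

theorem mem_adTraceIdeal {x : L} : x ∈ adTraceIdeal F L ↔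
    ∀ b ∈ adEnveloping F L, LinearMap.trace F L (ad F L x * b) = 0 := Iff.rfl

/-- The elements of a nilpotent ideal act nilpotently on the whole algebra. -/
theorem isNilpotent_ad_of_mem_nilpotent_ideal (I : LieIdeal F L) [hI : LieRing.IsNilpotent I]
    {x : L} (hx : x ∈ I) : IsNilpotent (ad F L x) := by
  obtain ⟨k, hk⟩ := LieModule.exists_forall_pow_toEnd_eq_zero F I I
  have hpow : ∀ (n : ℕ) (z : I), (ad F L x ^ n) z = ((ad F I ⟨x, hx⟩ ^ n) z : I) := by
    intro n
    induction n with
    | zero => simp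
    | succ n ih =>
      intro z
      rw [pow_succ', pow_succ', Module.End.mul_apply, Module.End.mul_apply, ih]
      rfl
  refine ⟨k + 1, LinearMap.ext fun y => ?_⟩
  rw [pow_succ, Module.End.mul_apply]
  have hy : ad F L x y ∈ I := lie_mem_left F L I x y hx
  have := hpow k ⟨_, hy⟩
  rw [show ad F I ⟨x, hx⟩ ^ k = 0 from hk _] at this
  simpa using this

variable [FiniteDimensional F L]

/-- **Engel's theorem** for ideals. -/
theorem isNilpotent_ideal_of_forall_isNilpotent_ad (I : LieIdeal F L)
    (h : ∀ x ∈ I, IsNilpotent (ad F L x)) : LieRing.IsNilpotent I := by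
  rw [LieAlgebra.isNilpotent_iff_forall (R := F)]
  rintro ⟨x, hx⟩
  exact LieSubalgebra.isNilpotent_ad_of_isNilpotent_ad (I : LieSubalgebra F L) (x := ⟨x, hx⟩)
    (h x hx)

/-- The terms `I.lcs L n` are stable under `b`, while `ad x` moves each into the next, so `ad x * b`
is nilpotent. -/
theorem nilpotent_ideal_le_adTraceIdeal (I : LieIdeal F L) [LieRing.IsNilpotent I] :
    I ≤ adTraceIdeal F L := by
  intro x hx b hb
  have hnil : LieModule.IsNilpotent I L := by
    rw [LieModule.isNilpotent_iff_forall' (R := F)]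
    rintro ⟨y, hy⟩
    exact isNilpotent_ad_of_mem_nilpotent_ideal I hy
  obtain ⟨k, hk⟩ := LieModule.IsNilpotent.nilpotent F I L
  have hbot : I.lcs L k = ⊥ := by
    rw [← LieSubmodule.toSubmodule_inj, LieIdeal.coe_lcs_eq, hk]
    rfl
  have hstable : ∀ n, ∀ z ∈ I.lcs L n, b z ∈ I.lcs L n := by
    intro n
    induction hb using Algebra.adjoin_induction with
    | mem f hf =>
      obtain ⟨y, rfl⟩ := hf
      exact fun z hz => (I.lcs L n).lie_mem hz
    | algebraMap r => exact fun z hz => (I.lcs L n).smul_mem r hz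
    | add f g _ _ hf hg => exact fun z hz => add_mem (hf z hz) (hg z hz)
    | mul f g _ _ hf hg => exact fun z hz => hf _ (hg z hz)
  have hpow : ∀ (n : ℕ) (z : L), ((ad F L x * b) ^ n) z ∈ I.lcs L n := by
    intro n
    induction n with
    | zero => simp
    | succ n ih =>
      intro z
      rw [pow_succ', Module.End.mul_apply, LieIdeal.lcs_succ]
      exact LieSubmodule.lie_mem_lie hx (hstable n _ (ih z))
  refine (LinearMap.isNilpotent_trace_of_isNilpotent ⟨k, LinearMap.ext fun z => ?_⟩).eq_zero
  simpa [hbot] using hpow k z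

variable [CharZero F]

theorem isNilpotent_adTraceIdeal : LieRing.IsNilpotent (adTraceIdeal F L) := by
  refine isNilpotent_ideal_of_forall_isNilpotent_ad _ fun x hx =>
    Module.End.isNilpotent_of_forall_trace_pow_eq_zero _ fun k => ?_
  rw [pow_succ']
  exact hx _ (pow_mem (ad_mem_adEnveloping x) k)

theorem nilpotentRadical_eq_adTraceIdeal : nilpotentRadical F L = adTraceIdeal F L := by
  refine le_antisymm (sSup_le fun I hI => ?_) (le_sSup isNilpotent_adTraceIdeal)
  have : LieRing.IsNilpotent I := hI
  exact nilpotent_ideal_le_adTraceIdeal I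

/-! ### The radical in terms of the nilradical. -/

omit [FiniteDimensional F L] [CharZero F] in
theorem trace_mul_pow_commutator_eq_zero {s x y : L} (h : ⁅s, x⁆ ∈ adTraceIdeal F L) (n : ℕ) :
    LinearMap.trace F L (ad F L y * (ad F L s ^ n * ad F L x - ad F L x * ad F L s ^ n)) = 0 := by
  -- A general `b` is needed: cyclicity of the trace moves a factor `ad s` in front of it.
  have key : ∀ (n : ℕ), ∀ b ∈ adEnveloping F L, LinearMap.trace F L
      (b * (ad F L s ^ n * ad F L x - ad F L x * ad F L s ^ n)) = 0 := by
    intro n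
    induction n with
    | zero => simp
    | succ n ih =>
      intro b hb
      have hs := pow_mem (ad_mem_adEnveloping (F := F) s) n
      have e : b * (ad F L s ^ (n + 1) * ad F L x - ad F L x * ad F L s ^ (n + 1)) =
          b * ad F L s ^ n * ad F L ⁅s, x⁆ +
            b * (ad F L s ^ n * ad F L x - ad F L x * ad F L s ^ n) * ad F L s := by
        rw [ad_lie_eq_mul_sub_mul, pow_succ]
        noncomm_ring
      rw [e, map_add, LinearMap.trace_mul_comm, h _ (mul_mem hb hs), LinearMap.trace_mul_comm,
        ← mul_assoc, ih _ (mul_mem (ad_mem_adEnveloping s) hb), add_zero]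
  exact key n _ (ad_mem_adEnveloping y)

theorem lie_ideal_le_adTraceIdeal {I J : LieIdeal F L} (h : ⁅⁅I, J⁆, I⁆ ≤ adTraceIdeal F L) :
    ⁅I, J⁆ ≤ adTraceIdeal F L := by
  suffices LieRing.IsNilpotent (⁅I, J⁆ : LieIdeal F L) from nilpotent_ideal_le_adTraceIdeal _
  refine isNilpotent_ideal_of_forall_isNilpotent_ad _ fun s hs =>
    Module.End.isNilpotent_of_forall_trace_pow_eq_zero _ fun n => ?_
  -- Separating `t` from `s` makes the claim linear in `t`, so brackets suffice.
  suffices ∀ t ∈ ⁅I, J⁆, LinearMap.trace F L (ad F L t * ad F L s ^ n) = 0 by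
    rw [pow_succ']
    exact this s hs
  intro t ht
  rw [← LieSubmodule.mem_toSubmodule, LieSubmodule.lieIdeal_oper_eq_linear_span'] at ht
  induction ht using Submodule.span_induction with
  | mem t ht =>
    obtain ⟨x, hx, y, -, rfl⟩ := ht
    have hsx : ⁅s, x⁆ ∈ adTraceIdeal F L := h (LieSubmodule.lie_mem_lie hs hx)
    rw [← trace_mul_pow_commutator_eq_zero (y := y) hsx n, ad_lie_eq_mul_sub_mul, sub_mul,
      mul_sub, map_sub, map_sub, mul_assoc, LinearMap.trace_mul_comm, mul_assoc, mul_assoc]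
  | zero => simp
  | add t u _ _ ht hu => rw [map_add, add_mul, map_add, ht, hu, add_zero]
  | smul c t _ ht => rw [map_smul, smul_mul_assoc, map_smul, ht, smul_zero]

/-- Induction on derived length, using `lie_ideal_le_adTraceIdeal` twice: first to put `[I, I]` in
`T`, then `[I, L]`, as `[[I, L], I] ⊆ [I, I]`. -/
theorem solvable_ideal_lie_top_le_adTraceIdeal (I : LieIdeal F L) [hI : IsSolvable I] :
    ⁅I, (⊤ : LieIdeal F L)⁆ ≤ adTraceIdeal F L := by
  obtain ⟨k, hk⟩ := IsSolvable.solvable F I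
  rw [LieIdeal.derivedSeries_eq_bot_iff] at hk
  clear hI
  induction k generalizing I with
  | zero =>
    rw [derivedSeriesOfIdeal_zero] at hk
    simp [hk]
  | succ k ih =>
    rw [derivedSeriesOfIdeal_add] at hk
    have hD : ⁅⁅I, I⁆, (⊤ : LieIdeal F L)⁆ ≤ adTraceIdeal F L := ih _ hk
    have hII : ⁅I, I⁆ ≤ adTraceIdeal F L :=
      lie_ideal_le_adTraceIdeal ((LieSubmodule.mono_lie_right _ le_top).trans hD)
    exact lie_ideal_le_adTraceIdeal ((LieSubmodule.mono_lie_left _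
      (LieSubmodule.lie_le_right _ _ |>.trans_eq' (LieSubmodule.lie_comm _ _))).trans hII)

/-- In characteristic zero the radical is the preimage of the centre modulo the nilradical. -/
theorem mem_radical_iff_forall_lie_mem_nilpotentRadical {x : L} :
    x ∈ radical F L ↔ ∀ y, ⁅x, y⁆ ∈ nilpotentRadical F L := by
  rw [nilpotentRadical_eq_adTraceIdeal]
  constructor
  · exact fun hx y => solvable_ideal_lie_top_le_adTraceIdeal (radical F L)
      (LieSubmodule.lie_mem_lie hx (LieSubmodule.mem_top y))
  · intro hx
    -- `Z` is solvable because `[Z, Z]` lies in the nilpotent ideal `T`.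
    let Z : LieIdeal F L :=
      { carrier := {x | ∀ y, ⁅x, y⁆ ∈ adTraceIdeal F L}
        add_mem' := fun ha hb y => by rw [add_lie]; exact add_mem (ha y) (hb y)
        zero_mem' := fun y => by rw [zero_lie]; exact zero_mem _
        smul_mem' := fun c a ha y => by rw [smul_lie]; exact Submodule.smul_mem _ c (ha y)
        lie_mem := fun {z a} ha y => by
          rw [lie_lie]
          exact sub_mem (LieSubmodule.lie_mem _ (ha y)) (ha ⁅z, y⁆) }
    have hT : IsSolvable (adTraceIdeal F L) := by
      have := isNilpotent_adTraceIdeal (F := F) (L := L)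
      infer_instance
    have hle : derivedSeriesOfIdeal F L 1 Z ≤ adTraceIdeal F L := by
      rw [derivedSeriesOfIdeal_succ, derivedSeriesOfIdeal_zero, LieSubmodule.lieIdeal_oper_eq_span,
        LieSubmodule.lieSpan_le]
      rintro _ ⟨a, b, rfl⟩
      exact a.2 b
    obtain ⟨k, hk⟩ := IsSolvable.solvable F (adTraceIdeal F L)
    rw [LieIdeal.derivedSeries_eq_bot_iff] at hk
    have hZ : IsSolvable Z := by
      refine IsSolvable.mk (R := F) (k := k + 1) ((LieIdeal.derivedSeries_eq_bot_iff Z _).mpr ?_)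
      rw [derivedSeriesOfIdeal_add, eq_bot_iff, ← hk]
      exact derivedSeriesOfIdeal_le hle le_rfl
    exact (LieIdeal.solvable_iff_le_radical F L Z).mp hZ hx

end LieAlgebra

/-! ### Compatibility with the grading. -/

namespace LieAlgebra

variable {F L G : Type*} [Field F] [LieRing L] [LieAlgebra F L] [Group G] [DecidableEq G]
  (ℒ : G → Submodule F L) [DirectSum.Decomposition ℒ]

/-- The elements of the enveloping algebra of the adjoint representation which are homogeneous
operators. -/
def homogeneousAdEnveloping : Set (Module.End F L) :=
  {b | b ∈ adEnveloping F L ∧ ∃ h : G, ∀ k, Set.MapsTo b (ℒ k) (ℒ (h * k))}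

variable {ℒ}

theorem adEnveloping_le_span_homogeneous
    (hℒ : ∀ (g h : G) (x y : L), x ∈ ℒ g → y ∈ ℒ h → ⁅x, y⁆ ∈ ℒ (g * h))
    {b : Module.End F L} (hb : b ∈ adEnveloping F L) :
    b ∈ Submodule.span F (homogeneousAdEnveloping ℒ) := by
  classical
  induction hb using Algebra.adjoin_induction with
  | mem f hf =>
    obtain ⟨x, rfl⟩ := hf
    rw [← DirectSum.sum_support_decompose ℒ x, map_sum]
    exact sum_mem fun i _ => Submodule.subset_span ⟨ad_mem_adEnveloping _, i, fun k y hy =>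
      hℒ i k _ y (SetLike.coe_mem _) hy⟩
  | algebraMap r =>
    rw [Algebra.algebraMap_eq_smul_one]
    exact Submodule.smul_mem _ _ (Submodule.subset_span ⟨one_mem _, 1, fun k y hy => by
      simpa using hy⟩)
  | add f g _ _ hf hg => exact add_mem hf hg
  | mul f g _ _ hf hg =>
    refine Submodule.span_mono ?_ ((Submodule.span_mul_span F _ _).le (Submodule.mul_mem_mul hf hg))
    rintro _ ⟨a, ⟨ha, i, hi⟩, c, ⟨hc, j, hj⟩, rfl⟩
    refine ⟨mul_mem ha hc, i * j, fun k y hy => ?_⟩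
    rw [mul_assoc]
    exact hi _ (hj k hy)

variable [FiniteDimensional F L]

theorem trace_eq_zero_of_mapsTo_mul {g : G} (hg : g ≠ 1) {f : Module.End F L}
    (hf : ∀ k, Set.MapsTo f (ℒ k) (ℒ (g * k))) : LinearMap.trace F L f = 0 :=
  LinearMap.trace_eq_zero_of_mapsTo_ne (DirectSum.Decomposition.isInternal ℒ) (g * ·)
    (fun k hk => hg (by simpa using hk)) hf

theorem isHomogeneous_adTraceIdeal
    (hℒ : ∀ (g h : G) (x y : L), x ∈ ℒ g → y ∈ ℒ h → ⁅x, y⁆ ∈ ℒ (g * h)) :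
    DirectSum.SetLike.IsHomogeneous ℒ (adTraceIdeal F L) := by
  classical
  intro i x hx b hb
  replace hb := adEnveloping_le_span_homogeneous hℒ hb
  induction hb using Submodule.span_induction with
  | mem b hb =>
    obtain ⟨hb, h, hbh⟩ := hb
    -- Only the component of `x` of degree `h⁻¹` can contribute to `tr (ad x * b)`, so that
    -- component inherits the vanishing from `x`.
    have hzero : ∀ j, j * h ≠ 1 →
        LinearMap.trace F L (ad F L (DirectSum.decompose ℒ x j : L) * b) = 0 := by
      refine fun j hj => trace_eq_zero_of_mapsTo_mul (ℒ := ℒ) hj fun k y hy => ?_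
      rw [mul_assoc]
      exact hℒ _ _ _ _ (SetLike.coe_mem _) (hbh k hy)
    by_cases hi : i * h = 1
    · have hxb := hx b hb
      rw [← DirectSum.sum_support_decompose ℒ x, map_sum, Finset.sum_mul, map_sum,
        Finset.sum_eq_single i] at hxb
      · exact hxb
      · exact fun j _ hj => hzero j fun hj' => hj (mul_right_cancel (hj'.trans hi.symm))
      · intro hi'
        rw [DFinsupp.notMem_support_iff.mp hi']
        simp
    · exact hzero i hi
  | zero => simp
  | add b c _ _ hb hc => rw [mul_add, map_add, hb, hc, add_zero]
  | smul r b _ hb => rw [mul_smul_comm, map_smul, hb, smul_zero]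

omit [FiniteDimensional F L] in
theorem decompose_lie_homogeneous
    (hℒ : ∀ (g h : G) (x y : L), x ∈ ℒ g → y ∈ ℒ h → ⁅x, y⁆ ∈ ℒ (g * h))
    (x : L) {j : G} {y : L} (hy : y ∈ ℒ j) (i : G) :
    (DirectSum.decompose ℒ ⁅x, y⁆ (i * j) : L) = ⁅(DirectSum.decompose ℒ x i : L), y⁆ := by
  induction x using DirectSum.Decomposition.inductionOn ℒ with
  | zero => simp
  | @homogeneous k x =>
    have hxy := hℒ k j x y x.2 hy
    by_cases hki : k = i
    · subst hki
      rw [DirectSum.decompose_of_mem_same ℒ hxy, DirectSum.decompose_of_mem_same ℒ x.2]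
    · rw [DirectSum.decompose_of_mem_ne ℒ hxy (fun h => hki (mul_right_cancel h)),
        DirectSum.decompose_of_mem_ne ℒ x.2 hki, zero_lie]
  | add a b ha hb => simp [ha, hb]

end LieAlgebra

theorem mainTheorem5 {F L G : Type*} [Field F] [CharZero F]
    [LieRing L] [LieAlgebra F L] [FiniteDimensional F L]
    [Group G] [DecidableEq G]
    (ℒ : G → Submodule F L) [DirectSum.Decomposition ℒ]
    (hℒ : ∀ (g h : G) (x y : L), x ∈ ℒ g → y ∈ ℒ h → ⁅x, y⁆ ∈ ℒ (g * h)) :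
    DirectSum.SetLike.IsHomogeneous ℒ (LieAlgebra.radical F L) ∧
      DirectSum.SetLike.IsHomogeneous ℒ (LieAlgebra.nilpotentRadical F L) := by
  have hN : DirectSum.SetLike.IsHomogeneous ℒ (LieAlgebra.nilpotentRadical F L) := by
    rw [LieAlgebra.nilpotentRadical_eq_adTraceIdeal]
    exact LieAlgebra.isHomogeneous_adTraceIdeal hℒ
  refine ⟨fun i x hx => ?_, hN⟩
  rw [LieAlgebra.mem_radical_iff_forall_lie_mem_nilpotentRadical] at hx ⊢
  intro y
  induction y using DirectSum.Decomposition.inductionOn ℒ with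
  | zero => simp
  | @homogeneous j y =>
    rw [← LieAlgebra.decompose_lie_homogeneous hℒ x y.2 i]
    exact hN (i * j) (hx y)
  | add a b ha hb => rw [lie_add]; exact add_mem ha hb
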